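/- Let $(M,\varphi,\xi,\eta,g)$ be a connected smooth (Hausdorff, second countable) $3$-manifold with an almost paracontact metric structure: $\varphi$ is a smooth $(1,1)$-tensor, $\xi$ a smooth vector field (the Reeb field), $\eta$ a smooth $1$-form with $$\varphi\xi=0,\qquad \eta\circ\varphi=0,\qquad \eta(\xi)=1,\qquad \varphi^2=\mathrm{Id}-\eta\otimes\xi,$$ the eigenspaces of $\varphi|_{\ker\eta}$ for the eigenvalues $1$ and $-1$ have equal dimension, and $g$ is a pseudo-Riemannian metric with $g(\varphi X,\varphi Y)=-g(X,Y)+\eta(X)\eta(Y)$. Let $\nabla$ be the Levi-Civita connection of $g$. Assume that the structure is normal, i.e. $[\varphi,\varphi]-2\,d\eta\otimes\xi=0$, where $[\varphi,\varphi](X,Y)=\varphi^2[X,Y]+[\varphi X,\varphi Y]-\varphi[\varphi X,Y]-\varphi[X,\varphi Y]$ and $2\,d\eta(X,Y)=X(\eta(Y))-Y(\eta(X))-\eta([X,Y])$. **Theorem.** If $\xi$ is affine Killing, i.e. $(\mathcal L_\xi\nabla)(X,Y)=[\xi,\nabla_XY]-\nabla_{[\xi,X]}Y-\nabla_X[\xi,Y]=0$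 for all vector fields $X,Y$, then $\xi$ is Killing, i.e. $\mathcal L_\xi g=0$. Moreover, in this case, let $\operatorname{tr}(\varphi\nabla\xi)$ denote the function given at each point by the trace of $v\mapsto\varphi(\nabla_v\xi)$. 1. If $\operatorname{tr}(\varphi\nabla\xi)\neq0$, then $(M,\varphi,\xi,\eta,g)$ is quasi-para-Sasakian: there is a smooth function $\bar\beta\neq0$ with $$(\nabla_X\varphi)Y=\bar\beta\,\bigl(g(X,Y)\xi-\eta(Y)X\bigr)\quad\text{for all } X,Y.$$ This holds with "$\neq0$" read in both places as "not identically zero", and also with "$\neq 0$" read in both places as "nowhere zero". 2. If $\operatorname{tr}(\varphi\nabla\xi)=0$ identically, then $(M,\varphi,\xi,\eta,g)$ is para-cosymplectic, i.e. (it is normal and) $\nabla\varphi=0$. -/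

import Mathlib

open Bundle Set VectorField
open scoped Manifold ContDiff Topology

noncomputable section

section Geometry

variable {E : Type*} [NormedAddCommGroup E] [NormedSpace ℝ E]
  {H : Type*} [TopologicalSpace H] (I : ModelWithCorners ℝ E H)
  (M : Type*) [TopologicalSpace M] [ChartedSpace H M] [IsManifold I ∞ M]

/-- A smooth pseudo-Riemannian metric: a smooth field of symmetric nondegenerate bilinear forms on
the tangent spaces. -/
structure PseudoRiemannianMetric where
  /-- the bilinear form on each tangent space -/
  form : ∀ x : M, TangentSpace I x →L[ℝ] TangentSpace I x →L[ℝ] ℝ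
  symm : ∀ (x : M) (v w : TangentSpace I x), form x v w = form x w v
  nondegenerate : ∀ (x : M) (v : TangentSpace I x), (∀ w, form x v w = 0) → v = 0
  contMDiff : ContMDiff I (I.prod 𝓘(ℝ, E →L[ℝ] E →L[ℝ] ℝ)) ∞
    (fun x ↦ TotalSpace.mk' (E →L[ℝ] E →L[ℝ] ℝ)
      (E := fun x : M ↦ TangentSpace I x →L[ℝ] TangentSpace I x →L[ℝ] ℝ) x (form x))

/-- An almost paracontact metric structure `(φ, ξ, η, g)`. -/
structure AlmostParacontactMetric where
  /-- the `(1,1)`-tensor -/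
  φ : ∀ x : M, TangentSpace I x →L[ℝ] TangentSpace I x
  /-- the Reeb vector field -/
  ξ : ∀ x : M, TangentSpace I x
  /-- the `1`-form -/
  η : ∀ x : M, TangentSpace I x →L[ℝ] ℝ
  /-- the metric -/
  g : PseudoRiemannianMetric I M
  contMDiff_φ : ContMDiff I (I.prod 𝓘(ℝ, E →L[ℝ] E)) ∞
    (fun x ↦ TotalSpace.mk' (E →L[ℝ] E)
      (E := fun x : M ↦ TangentSpace I x →L[ℝ] TangentSpace I x) x (φ x))
  contMDiff_ξ : ContMDiff I (I.prod 𝓘(ℝ, E)) ∞ (fun x ↦ TotalSpace.mk' E x (ξ x))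
  contMDiff_η : ContMDiff I (I.prod 𝓘(ℝ, E →L[ℝ] ℝ)) ∞
    (fun x ↦ TotalSpace.mk' (E →L[ℝ] ℝ)
      (E := fun x : M ↦ TangentSpace I x →L[ℝ] ℝ) x (η x))
  φ_ξ : ∀ x, φ x (ξ x) = 0
  η_φ : ∀ x v, η x (φ x v) = 0
  η_ξ : ∀ x, η x (ξ x) = 1
  φ_sq : ∀ x v, φ x (φ x v) = v - η x v • ξ x
  /-- The eigenspaces of `φ` on `ker η` for the eigenvalues `1` and `-1` have the same
  dimension. -/
  finrank_eigenspaces : ∀ x,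
    Module.finrank ℝ
        ↥(LinearMap.ker (η x).toLinearMap ⊓ Module.End.eigenspace (φ x).toLinearMap 1) =
      Module.finrank ℝ
        ↥(LinearMap.ker (η x).toLinearMap ⊓ Module.End.eigenspace (φ x).toLinearMap (-1))
  compatible : ∀ x v w, g.form x (φ x v) (φ x w) = -g.form x v w + η x v * η x w

variable {I M}

/-- The vector field `X` is smooth near `x`. -/
def SmoothFieldAt (X : ∀ x : M, TangentSpace I x) (x : M) : Prop :=
  ContMDiffAt I (I.prod 𝓘(ℝ, E)) ∞ (fun y ↦ TotalSpace.mk' E y (X y)) x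

/-- The vector field `X` is differentiable at `x`. -/
def DifferentiableFieldAt (X : ∀ x : M, TangentSpace I x) (x : M) : Prop :=
  MDifferentiableAt I (I.prod 𝓘(ℝ, E)) (fun y ↦ TotalSpace.mk' E y (X y)) x

namespace PseudoRiemannianMetric

variable (g : PseudoRiemannianMetric I M)

/-- The right-hand side of the Koszul formula at the point `x`,
`X g(Y,Z) + Y g(X,Z) - Z g(X,Y) + g([X,Y],Z) - g([X,Z],Y) - g([Y,Z],X)`. -/
def koszul (X Y Z : ∀ x : M, TangentSpace I x) (x : M) : ℝ :=
  mvfderiv I (fun y ↦ g.form y (Y y) (Z y)) x (X x)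
    + mvfderiv I (fun y ↦ g.form y (X y) (Z y)) x (Y x)
    - mvfderiv I (fun y ↦ g.form y (X y) (Y y)) x (Z x)
    + g.form x (mlieBracket I X Y x) (Z x)
    - g.form x (mlieBracket I X Z x) (Y x)
    - g.form x (mlieBracket I Y Z x) (X x)

/-- `A` is the covariant derivative `v ↦ ∇_v Y` at the point `x`, for the Levi-Civita connection
of `g`: it satisfies the Koszul formula `2 g(A X, Z) = koszul X Y Z`. -/
def IsCovDerivAt (Y : ∀ x : M, TangentSpace I x) (x : M)
    (A : TangentSpace I x →L[ℝ] TangentSpace I x) : Prop :=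
  ∀ X Z : ∀ x : M, TangentSpace I x, DifferentiableFieldAt X x → DifferentiableFieldAt Z x →
    2 * g.form x (A (X x)) (Z x) = g.koszul X Y Z x

open Classical in
/-- The Levi-Civita connection of `g`: `g.nabla Y x v` is `∇_v Y` at the point `x`. Where `Y` is
not differentiable the value is irrelevant (it is `0` when the Koszul formula has no solution). -/
def nabla (Y : ∀ x : M, TangentSpace I x) (x : M) : TangentSpace I x →L[ℝ] TangentSpace I x :=
  if h : ∃ A, g.IsCovDerivAt Y x A then h.choose else 0

/-- The vector field `∇_X Y`. -/
def cov (X Y : ∀ x : M, TangentSpace I x) (x : M) : TangentSpace I x :=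
  g.nabla Y x (X x)

/-- `(L_V g)(X, Y) = V g(X,Y) - g([V,X],Y) - g(X,[V,Y])`. -/
def lieDeriv (V X Y : ∀ x : M, TangentSpace I x) (x : M) : ℝ :=
  mvfderiv I (fun y ↦ g.form y (X y) (Y y)) x (V x)
    - g.form x (mlieBracket I V X x) (Y x) - g.form x (X x) (mlieBracket I V Y x)

/-- `V` is a Killing vector field: `L_V g = 0`. -/
def IsKilling (V : ∀ x : M, TangentSpace I x) : Prop :=
  ∀ (x : M) (X Y : ∀ x : M, TangentSpace I x), SmoothFieldAt X x → SmoothFieldAt Y x →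
    g.lieDeriv V X Y x = 0

/-- `(L_V ∇)(X, Y) = [V, ∇_X Y] - ∇_{[V,X]} Y - ∇_X [V,Y]`. -/
def lieDerivNabla (V X Y : ∀ x : M, TangentSpace I x) (x : M) : TangentSpace I x :=
  mlieBracket I V (g.cov X Y) x - g.cov (mlieBracket I V X) Y x - g.cov X (mlieBracket I V Y) x

/-- `V` is an affine Killing vector field: `L_V ∇ = 0`. -/
def IsAffineKilling (V : ∀ x : M, TangentSpace I x) : Prop :=
  ∀ (x : M) (X Y : ∀ x : M, TangentSpace I x), SmoothFieldAt X x → SmoothFieldAt Y x →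
    g.lieDerivNabla V X Y x = 0

end PseudoRiemannianMetric

namespace AlmostParacontactMetric

variable (S : AlmostParacontactMetric I M)

/-- The vector field `φ X`. -/
def phi (X : ∀ x : M, TangentSpace I x) (x : M) : TangentSpace I x := S.φ x (X x)

/-- `2 dη(X, Y) = X(η(Y)) - Y(η(X)) - η([X,Y])`. -/
def twoDeta (X Y : ∀ x : M, TangentSpace I x) (x : M) : ℝ :=
  mvfderiv I (fun y ↦ S.η y (Y y)) x (X x) - mvfderiv I (fun y ↦ S.η y (X y)) x (Y x)
    - S.η x (mlieBracket I X Y x)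

/-- The Nijenhuis torsion
`[φ,φ](X, Y) = φ²[X,Y] + [φX,φY] - φ[φX,Y] - φ[X,φY]`. -/
def nijenhuis (X Y : ∀ x : M, TangentSpace I x) (x : M) : TangentSpace I x :=
  S.φ x (S.φ x (mlieBracket I X Y x)) + mlieBracket I (S.phi X) (S.phi Y) x
    - S.φ x (mlieBracket I (S.phi X) Y x) - S.φ x (mlieBracket I X (S.phi Y) x)

/-- The structure is normal: `[φ,φ] - 2 dη ⊗ ξ = 0`. -/
def IsNormal : Prop :=
  ∀ (x : M) (X Y : ∀ x : M, TangentSpace I x), SmoothFieldAt X x → SmoothFieldAt Y x →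
    S.nijenhuis X Y x - S.twoDeta X Y x • S.ξ x = 0

/-- `(∇_X φ) Y = ∇_X (φ Y) - φ (∇_X Y)`. -/
def nablaPhi (X Y : ∀ x : M, TangentSpace I x) (x : M) : TangentSpace I x :=
  S.g.cov X (S.phi Y) x - S.φ x (S.g.cov X Y x)

/-- The equation
`(∇_X φ) Y = α (g(φX,Y) ξ - η(Y) φX) + β (g(X,Y) ξ - η(Y) X)` for all vector fields `X`, `Y`. -/
def HasNablaPhi (α β : M → ℝ) : Prop :=
  ∀ (x : M) (X Y : ∀ x : M, TangentSpace I x), SmoothFieldAt X x → SmoothFieldAt Y x →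
    S.nablaPhi X Y x =
      α x • (S.g.form x (S.φ x (X x)) (Y x) • S.ξ x - S.η x (Y x) • S.φ x (X x))
      + β x • (S.g.form x (X x) (Y x) • S.ξ x - S.η x (Y x) • X x)

/-- Quasi-para-Sasakian: normal, with `α = 0` and `β` not the zero function. -/
def IsQuasiParaSasakian : Prop :=
  S.IsNormal ∧ ∃ β : M → ℝ, ContMDiff I 𝓘(ℝ, ℝ) ∞ β ∧ S.HasNablaPhi 0 β ∧ ∃ x, β x ≠ 0

/-- Quasi-para-Sasakian in the strict sense: normal, with `α = 0` and `β` vanishing nowhere. -/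
def IsStrictlyQuasiParaSasakian : Prop :=
  S.IsNormal ∧ ∃ β : M → ℝ, ContMDiff I 𝓘(ℝ, ℝ) ∞ β ∧ S.HasNablaPhi 0 β ∧ ∀ x, β x ≠ 0

/-- Para-cosymplectic: normal, with `α = β = 0`. -/
def IsParaCosymplectic : Prop := S.IsNormal ∧ S.HasNablaPhi 0 0

/-- The function `tr(φ∇ξ)`, the trace of `v ↦ φ (∇_v ξ)`. -/
def trPhiNablaXi (x : M) : ℝ :=
  LinearMap.trace ℝ (TangentSpace I x) ((S.φ x).comp (S.g.nabla S.ξ x)).toLinearMap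

end AlmostParacontactMetric

end Geometry

/-! The Koszul formula determines the connection uniquely and is always solvable. -/

section LeviCivita

variable {E : Type*} [NormedAddCommGroup E] [NormedSpace ℝ E]
  {H : Type*} [TopologicalSpace H] {I : ModelWithCorners ℝ E H}
  {M : Type*} [TopologicalSpace M] [ChartedSpace H M] [IsManifold I ∞ M]
  (g : PseudoRiemannianMetric I M) {X Y Z : ∀ x : M, TangentSpace I x} {x : M}

namespace PseudoRiemannianMetric

theorem mdifferentiableAt_form (hX : DifferentiableFieldAt X x) (hY : DifferentiableFieldAt Y x) :
    MDifferentiableAt I 𝓘(ℝ, ℝ) (fun y ↦ g.form y (X y) (Y y)) x := by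
  have hg := (g.contMDiff.mdifferentiable (by simp)) x
  have : MDifferentiableAt I (I.prod 𝓘(ℝ, ℝ))
      (fun y ↦ TotalSpace.mk' ℝ (E := Bundle.Trivial M ℝ) y (g.form y (X y) (Y y))) x := by
    apply MDifferentiableAt.clm_bundle_apply₂ (F₁ := E) (F₂ := E) (b := fun y ↦ y)
      (ψ := fun y ↦ g.form y)
    · exact hg
    · exact hX
    · exact hY
  simp only [mdifferentiableAt_totalSpace] at this
  exact this.2

theorem isCovDerivAt_unique {A B : TangentSpace I x →L[ℝ] TangentSpace I x}
    (hA : g.IsCovDerivAt Y x A) (hB : g.IsCovDerivAt Y x B) : A = B := by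
  ext v
  rw [← sub_eq_zero]
  refine g.nondegenerate x _ fun w ↦ ?_
  have hv : DifferentiableFieldAt (FiberBundle.extend E v) x := FiberBundle.mdifferentiableAt_extend ..
  have hw : DifferentiableFieldAt (FiberBundle.extend E w) x := FiberBundle.mdifferentiableAt_extend ..
  have h1 := hA _ _ hv hw
  have h2 := hB _ _ hv hw
  simp only [FiberBundle.extend_apply_self] at h1 h2
  simp
  linarith

variable [FiniteDimensional ℝ E]

theorem koszul_tensorial_left (hY : DifferentiableFieldAt Y x) (hZ : DifferentiableFieldAt Z x) :
    TensorialAt I E (fun X ↦ g.koszul X Y Z x) x where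
  smul {f X} hf hX := by
    have hXZ := g.mdifferentiableAt_form hX hZ
    have hXY := g.mdifferentiableAt_form hX hY
    have e1 : (fun y ↦ g.form y ((f • X) y) (Z y)) = f * (fun y ↦ g.form y (X y) (Z y)) := by
      ext y; simp
    have e2 : (fun y ↦ g.form y ((f • X) y) (Y y)) = f * (fun y ↦ g.form y (X y) (Y y)) := by
      ext y; simp
    have h1 := mlieBracket_smul_left (W := Y) hf hX
    have h2 := mlieBracket_smul_left (W := Z) hf hX
    simp only [koszul, e1, e2, h1, h2, mvfderiv_mul hf hXZ, mvfderiv_mul hf hXY]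
    simp
    ring
  add {X X'} hX hX' := by
    have hXZ := g.mdifferentiableAt_form hX hZ
    have hXY := g.mdifferentiableAt_form hX hY
    have hXZ' := g.mdifferentiableAt_form hX' hZ
    have hXY' := g.mdifferentiableAt_form hX' hY
    have e1 : (fun y ↦ g.form y ((X + X') y) (Z y)) =
        (fun y ↦ g.form y (X y) (Z y)) + (fun y ↦ g.form y (X' y) (Z y)) := by
      ext y; simp
    have e2 : (fun y ↦ g.form y ((X + X') y) (Y y)) =
        (fun y ↦ g.form y (X y) (Y y)) + (fun y ↦ g.form y (X' y) (Y y)) := by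
      ext y; simp
    have h1 := mlieBracket_add_left (W := Y) hX hX'
    have h2 := mlieBracket_add_left (W := Z) hX hX'
    simp only [koszul, e1, e2, h1, h2, mvfderiv_add hXZ hXZ', mvfderiv_add hXY hXY']
    simp
    ring

theorem koszul_tensorial_right (hX : DifferentiableFieldAt X x) (hY : DifferentiableFieldAt Y x) :
    TensorialAt I E (fun Z ↦ g.koszul X Y Z x) x where
  smul {f Z} hf hZ := by
    have hXZ := g.mdifferentiableAt_form hX hZ
    have hYZ := g.mdifferentiableAt_form hY hZ
    have e1 : (fun y ↦ g.form y (X y) ((f • Z) y)) = f * (fun y ↦ g.form y (X y) (Z y)) := by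
      ext y; simp
    have e2 : (fun y ↦ g.form y (Y y) ((f • Z) y)) = f * (fun y ↦ g.form y (Y y) (Z y)) := by
      ext y; simp
    have h1 := mlieBracket_smul_right (V := X) hf hZ
    have h2 := mlieBracket_smul_right (V := Y) hf hZ
    simp only [koszul, e1, e2, h1, h2, mvfderiv_mul hf hXZ, mvfderiv_mul hf hYZ]
    simp [g.symm x (Z x)]
    ring
  add {Z Z'} hZ hZ' := by
    have hXZ := g.mdifferentiableAt_form hX hZ
    have hYZ := g.mdifferentiableAt_form hY hZ
    have hXZ' := g.mdifferentiableAt_form hX hZ'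
    have hYZ' := g.mdifferentiableAt_form hY hZ'
    have e1 : (fun y ↦ g.form y (X y) ((Z + Z') y)) =
        (fun y ↦ g.form y (X y) (Z y)) + (fun y ↦ g.form y (X y) (Z' y)) := by
      ext y; simp
    have e2 : (fun y ↦ g.form y (Y y) ((Z + Z') y)) =
        (fun y ↦ g.form y (Y y) (Z y)) + (fun y ↦ g.form y (Y y) (Z' y)) := by
      ext y; simp
    have h1 := mlieBracket_add_right (V := X) hZ hZ'
    have h2 := mlieBracket_add_right (V := Y) hZ hZ'
    simp only [koszul, e1, e2, h1, h2, mvfderiv_add hXZ hXZ', mvfderiv_add hYZ hYZ']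
    simp
    ring

theorem exists_of_nondegenerate (b B : E →L[ℝ] E →L[ℝ] ℝ)
    (hb : ∀ v, (∀ w, b v w = 0) → v = 0) :
    ∃ A : E →L[ℝ] E, ∀ v w, 2 * b (A v) w = B v w := by
  let l : E →ₗ[ℝ] Module.Dual ℝ E := (ContinuousLinearMap.coeLM ℝ).comp b.toLinearMap
  have hl : Function.Injective l := by
    rw [← LinearMap.ker_eq_bot, LinearMap.ker_eq_bot']
    intro v hv
    exact hb v fun w ↦ by simpa [l] using LinearMap.congr_fun hv w
  let e : E ≃ₗ[ℝ] Module.Dual ℝ E :=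
    LinearEquiv.ofInjectiveOfFinrankEq l hl Subspace.dual_finrank_eq.symm
  refine ⟨LinearMap.toContinuousLinearMap ((2⁻¹ : ℝ) •
    (e.symm.toLinearMap.comp ((ContinuousLinearMap.coeLM ℝ).comp B.toLinearMap))), fun v w ↦ ?_⟩
  have h : ∀ f : Module.Dual ℝ E, b (e.symm f) w = f w := fun f ↦
    LinearMap.congr_fun (e.apply_symm_apply f) w
  simp [h]

theorem exists_isCovDerivAt (hY : DifferentiableFieldAt Y x) : ∃ A, g.IsCovDerivAt Y x A := by
  obtain ⟨A, hA⟩ := exists_of_nondegenerate (E := E) (g.form x)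
    (TensorialAt.mkHom₂ (fun X Z ↦ g.koszul X Y Z x) x
      (fun Z hZ ↦ g.koszul_tensorial_left hY hZ) (fun X hX ↦ g.koszul_tensorial_right hX hY))
    (g.nondegenerate x)
  refine ⟨A, fun X Z hX hZ ↦ (hA (X x) (Z x)).trans ?_⟩
  exact TensorialAt.mkHom₂_apply _ _ hX hZ

theorem isCovDerivAt_nabla (hY : DifferentiableFieldAt Y x) :
    g.IsCovDerivAt Y x (g.nabla Y x) := by
  have h := g.exists_isCovDerivAt hY
  rw [nabla, dif_pos h]
  exact h.choose_spec

/-- `∇` is torsion-free. -/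
theorem nabla_torsionFree (hX : DifferentiableFieldAt X x) (hY : DifferentiableFieldAt Y x) :
    g.cov X Y x - g.cov Y X x = mlieBracket I X Y x := by
  rw [← sub_eq_zero]
  refine g.nondegenerate x _ fun w ↦ ?_
  have hw : DifferentiableFieldAt (FiberBundle.extend E w) x := FiberBundle.mdifferentiableAt_extend ..
  have h1 := g.isCovDerivAt_nabla hY X _ hX hw
  have h2 := g.isCovDerivAt_nabla hX Y _ hY hw
  have h3 : (fun y ↦ g.form y (X y) (Y y)) = (fun y ↦ g.form y (Y y) (X y)) := by
    ext y; exact g.symm ..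
  simp only [koszul, FiberBundle.extend_apply_self] at h1 h2
  rw [mlieBracket_swap_apply (V := Y) (W := X)] at h2
  rw [h3] at h1
  simp only [cov, map_sub, map_neg, sub_apply, neg_apply] at h1 h2 ⊢
  linarith

/-- `∇` is compatible with the metric. -/
theorem nabla_metric (hX : DifferentiableFieldAt X x) (hY : DifferentiableFieldAt Y x)
    (hZ : DifferentiableFieldAt Z x) :
    mvfderiv I (fun y ↦ g.form y (Y y) (Z y)) x (X x) =
      g.form x (g.cov X Y x) (Z x) + g.form x (Y x) (g.cov X Z x) := by
  have h1 := g.isCovDerivAt_nabla hY X _ hX hZ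
  have h2 := g.isCovDerivAt_nabla hZ X _ hX hY
  have h3 : (fun y ↦ g.form y (Y y) (Z y)) = (fun y ↦ g.form y (Z y) (Y y)) := by
    ext y; exact g.symm ..
  simp only [koszul] at h1 h2
  rw [mlieBracket_swap_apply (V := Z) (W := Y), ← h3] at h2
  rw [g.symm x (Y x)]
  simp only [cov, map_neg, neg_apply] at h1 h2 ⊢
  linarith

end PseudoRiemannianMetric

end LeviCivita

end

section SmoothFields

variable {E : Type*} [NormedAddCommGroup E] [NormedSpace ℝ E]
  {H : Type*} [TopologicalSpace H] {I : ModelWithCorners ℝ E H}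
  {M : Type*} [TopologicalSpace M] [ChartedSpace H M]
  {X Y Z : ∀ x : M, TangentSpace I x} {x : M}

theorem mvfderiv_congr {f f' : M → ℝ} (h : f =ᶠ[𝓝 x] f') (v : TangentSpace I x) :
    mvfderiv I f x v = mvfderiv I f' x v := by
  simp only [mvfderiv, ContinuousLinearMap.comp_apply]
  rw [h.mfderiv_eq, h.eq_of_nhds]

variable [IsManifold I ∞ M]

theorem SmoothFieldAt.differentiableFieldAt (hX : SmoothFieldAt X x) :
    DifferentiableFieldAt X x :=
  ContMDiffAt.mdifferentiableAt hX (by simp)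

theorem SmoothFieldAt.eventually_differentiableFieldAt (hX : SmoothFieldAt X x) :
    ∀ᶠ y in 𝓝 x, DifferentiableFieldAt X y := by
  have h1 : ContMDiffAt I (I.prod 𝓘(ℝ, E)) 1 (fun y ↦ TotalSpace.mk' E y (X y)) x :=
    ContMDiffAt.of_le hX (by simp)
  filter_upwards [(contMDiffAt_iff_contMDiffAt_nhds (by simp)).1 h1] with y hy
  exact hy.mdifferentiableAt (by simp)

theorem SmoothFieldAt.mlieBracket [CompleteSpace E] (hX : SmoothFieldAt X x)
    (hY : SmoothFieldAt Y x) : SmoothFieldAt (mlieBracket I X Y) x := by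
  have : IsManifold I ((⊤ : ℕ∞) + 1) M := by simpa using (inferInstance : IsManifold I ∞ M)
  have : IsManifold I (minSmoothness ℝ 2) M := by
    simpa using (inferInstance : IsManifold I 2 M)
  exact ContMDiffAt.mlieBracket_vectorField (m := (⊤ : ℕ∞)) (n := (⊤ : ℕ∞)) hX hY (by simp)

theorem smoothFieldAt_extend [FiniteDimensional ℝ E] (v : TangentSpace I x) :
    SmoothFieldAt (FiberBundle.extend E v) x :=
  FiberBundle.contMDiffAt_extend ..

theorem differentiableFieldAt_zero : DifferentiableFieldAt (0 : ∀ x : M, TangentSpace I x) x :=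
  (Bundle.contMDiff_zeroSection ℝ (TangentSpace I : M → Type _) x).mdifferentiableAt one_ne_zero

namespace PseudoRiemannianMetric

variable (g : PseudoRiemannianMetric I M)

theorem contMDiffAt_form (hX : SmoothFieldAt X x) (hY : SmoothFieldAt Y x) :
    ContMDiffAt I 𝓘(ℝ, ℝ) ∞ (fun y ↦ g.form y (X y) (Y y)) x := by
  have : ContMDiffAt I (I.prod 𝓘(ℝ, ℝ)) ∞
      (fun y ↦ TotalSpace.mk' ℝ (E := Bundle.Trivial M ℝ) y (g.form y (X y) (Y y))) x := by
    apply ContMDiffAt.clm_bundle_apply₂ (F₁ := E) (F₂ := E) (b := fun y ↦ y)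
      (ψ := fun y ↦ g.form y)
    · exact g.contMDiff x
    · exact hX
    · exact hY
  simp only [contMDiffAt_totalSpace] at this
  exact this.2

variable [FiniteDimensional ℝ E]

theorem nabla_zero (v : TangentSpace I x) :
    g.nabla (0 : ∀ x : M, TangentSpace I x) x v = 0 := by
  refine g.nondegenerate x _ fun w ↦ ?_
  have hv := FiberBundle.mdifferentiableAt_extend (I := I) (F := E) v
  have hw := FiberBundle.mdifferentiableAt_extend (I := I) (F := E) w
  have h1 := g.nabla_metric hv differentiableFieldAt_zero hw
  simpa [cov, mvfderiv_const] using h1.symm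

end PseudoRiemannianMetric

namespace AlmostParacontactMetric

variable (S : AlmostParacontactMetric I M)

theorem smoothFieldAt_ξ : SmoothFieldAt S.ξ x := S.contMDiff_ξ x

theorem smoothFieldAt_phi (hX : SmoothFieldAt X x) : SmoothFieldAt (S.phi X) x := by
  apply ContMDiffAt.clm_bundle_apply (F₁ := E) (F₂ := E) (b := fun y ↦ y) (ϕ := fun y ↦ S.φ y)
  · exact S.contMDiff_φ x
  · exact hX

theorem differentiableFieldAt_phi (hX : DifferentiableFieldAt X x) :
    DifferentiableFieldAt (S.phi X) x := by
  apply MDifferentiableAt.clm_bundle_apply (F₁ := E) (F₂ := E) (b := fun y ↦ y)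
    (ϕ := fun y ↦ S.φ y)
  · exact (S.contMDiff_φ.mdifferentiable (by simp)) x
  · exact hX

theorem contMDiffAt_η (hX : SmoothFieldAt X x) :
    ContMDiffAt I 𝓘(ℝ, ℝ) ∞ (fun y ↦ S.η y (X y)) x := by
  have : ContMDiffAt I (I.prod 𝓘(ℝ, ℝ)) ∞
      (fun y ↦ TotalSpace.mk' ℝ (E := Bundle.Trivial M ℝ) y (S.η y (X y))) x := by
    apply ContMDiffAt.clm_bundle_apply (F₁ := E) (F₂ := ℝ) (b := fun y ↦ y) (ϕ := fun y ↦ S.η y)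
    · exact S.contMDiff_η x
    · exact hX
  simp only [contMDiffAt_totalSpace] at this
  exact this.2

/-- `X f = η([X, f ξ]) - f η([X, ξ])`. -/
theorem contMDiffAt_mvfderiv_apply (S : AlmostParacontactMetric I M) [CompleteSpace E] {f : M → ℝ}
    (hf : ContMDiffAt I 𝓘(ℝ, ℝ) ∞ f x) (hX : SmoothFieldAt X x) :
    ContMDiffAt I 𝓘(ℝ, ℝ) ∞ (fun y ↦ mvfderiv I f y (X y)) x := by
  have hfξ : SmoothFieldAt (f • S.ξ) x := ContMDiffAt.smul_section hf S.smoothFieldAt_ξ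
  have h := (S.contMDiffAt_η (hX.mlieBracket hfξ)).sub
    (hf.mul (S.contMDiffAt_η (hX.mlieBracket S.smoothFieldAt_ξ)))
  refine h.congr_of_eventuallyEq ?_
  have hf1 : ContMDiffAt I 𝓘(ℝ, ℝ) 1 f x := hf.of_le (by simp)
  filter_upwards [(contMDiffAt_iff_contMDiffAt_nhds (by simp)).1 hf1] with y hy
  have := mlieBracket_smul_right (V := X) (W := S.ξ) (hy.mdifferentiableAt (by simp))
    S.smoothFieldAt_ξ.differentiableFieldAt
  rw [this]
  simp [S.η_ξ]

theorem contMDiffAt_form_cov [FiniteDimensional ℝ E] (hX : SmoothFieldAt X x)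
    (hY : SmoothFieldAt Y x) (hZ : SmoothFieldAt Z x) :
    ContMDiffAt I 𝓘(ℝ, ℝ) ∞ (fun y ↦ S.g.form y (S.g.cov X Y y) (Z y)) x := by
  have hk : ContMDiffAt I 𝓘(ℝ, ℝ) ∞ (fun y ↦ 2⁻¹ * S.g.koszul X Y Z y) x :=
    contMDiffAt_const.mul <|
      (((((S.contMDiffAt_mvfderiv_apply (S.g.contMDiffAt_form hY hZ) hX).add
      (S.contMDiffAt_mvfderiv_apply (S.g.contMDiffAt_form hX hZ) hY)).sub
      (S.contMDiffAt_mvfderiv_apply (S.g.contMDiffAt_form hX hY) hZ)).add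
      (S.g.contMDiffAt_form (hX.mlieBracket hY) hZ)).sub
      (S.g.contMDiffAt_form (hX.mlieBracket hZ) hY)).sub
      (S.g.contMDiffAt_form (hY.mlieBracket hZ) hX)
  refine hk.congr_of_eventuallyEq ?_
  filter_upwards [hX.eventually_differentiableFieldAt, hY.eventually_differentiableFieldAt,
    hZ.eventually_differentiableFieldAt] with y hXy hYy hZy
  rw [← S.g.isCovDerivAt_nabla hYy X Z hXy hZy]
  simp [PseudoRiemannianMetric.cov]

end AlmostParacontactMetric

end SmoothFields

section StructureIdentities

variable {E : Type*} [NormedAddCommGroup E] [NormedSpace ℝ E]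
  {H : Type*} [TopologicalSpace H] {I : ModelWithCorners ℝ E H}
  {M : Type*} [TopologicalSpace M] [ChartedSpace H M] [IsManifold I ∞ M]
  {X Y Z : ∀ x : M, TangentSpace I x} {x : M}

namespace PseudoRiemannianMetric

variable [FiniteDimensional ℝ E] (g : PseudoRiemannianMetric I M)

theorem mvfderiv_form (hY : DifferentiableFieldAt Y x) (hZ : DifferentiableFieldAt Z x)
    (v : TangentSpace I x) :
    mvfderiv I (fun y ↦ g.form y (Y y) (Z y)) x v =
      g.form x (g.nabla Y x v) (Z x) + g.form x (Y x) (g.nabla Z x v) := by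
  have hv := FiberBundle.mdifferentiableAt_extend (I := I) (F := E) v
  simpa [cov] using g.nabla_metric hv hY hZ

theorem mlieBracket_eq_nabla (hX : DifferentiableFieldAt X x) (hY : DifferentiableFieldAt Y x) :
    mlieBracket I X Y x = g.nabla Y x (X x) - g.nabla X x (Y x) :=
  (g.nabla_torsionFree hX hY).symm

/-- `(L_V g)(X, Y) = g(∇_X V, Y) + g(X, ∇_Y V)`. -/
theorem lieDeriv_eq {V : ∀ x : M, TangentSpace I x} (hV : DifferentiableFieldAt V x)
    (hX : DifferentiableFieldAt X x) (hY : DifferentiableFieldAt Y x) :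
    g.lieDeriv V X Y x = g.form x (g.nabla V x (X x)) (Y x) +
      g.form x (X x) (g.nabla V x (Y x)) := by
  rw [lieDeriv, g.mvfderiv_form hX hY, g.mlieBracket_eq_nabla hV hX, g.mlieBracket_eq_nabla hV hY]
  simp only [map_sub, sub_apply]
  ring

end PseudoRiemannianMetric

namespace AlmostParacontactMetric

variable (S : AlmostParacontactMetric I M)

theorem form_ξ (v : TangentSpace I x) : S.g.form x v (S.ξ x) = S.η x v := by
  have h := S.compatible x v (S.ξ x)
  rw [S.φ_ξ, S.η_ξ, map_zero] at h
  linarith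

theorem form_φ (v w : TangentSpace I x) :
    S.g.form x (S.φ x v) w = -S.g.form x v (S.φ x w) := by
  have h := S.compatible x v (S.φ x w)
  rw [S.η_φ, S.φ_sq, map_sub, map_smul, S.form_ξ, S.η_φ] at h
  simpa using h

theorem form_φ_self (v : TangentSpace I x) : S.g.form x v (S.φ x v) = 0 := by
  have h := S.form_φ v v
  rw [S.g.symm] at h
  linarith

theorem φ_sq_of_η_eq_zero {v : TangentSpace I x} (hv : S.η x v = 0) : S.φ x (S.φ x v) = v := by
  rw [S.φ_sq, hv, zero_smul, sub_zero]

theorem phi_ξ : S.phi S.ξ = 0 := funext fun y ↦ S.φ_ξ y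

theorem phi_phi_of_η_eq_zero (hY : ∀ y, S.η y (Y y) = 0) : S.phi (S.phi Y) = Y :=
  funext fun y ↦ S.φ_sq_of_η_eq_zero (hY y)

/-- A vector in `ker η` extends to a smooth field in `ker η`. -/
theorem exists_smooth_extension [FiniteDimensional ℝ E] {v : TangentSpace I x}
    (hv : S.η x v = 0) :
    ∃ X : ∀ x : M, TangentSpace I x, SmoothFieldAt X x ∧ (∀ y, S.η y (X y) = 0) ∧ X x = v := by
  refine ⟨S.phi (S.phi (FiberBundle.extend E v)),
    S.smoothFieldAt_phi (S.smoothFieldAt_phi (smoothFieldAt_extend v)), fun y ↦ S.η_φ y _, ?_⟩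
  simp only [phi, FiberBundle.extend_apply_self]
  exact S.φ_sq_of_η_eq_zero hv

theorem differentiableFieldAt_ξ : DifferentiableFieldAt S.ξ x :=
  S.smoothFieldAt_ξ.differentiableFieldAt

/-- `(∇_v φ) Y`. -/
noncomputable def nablaPhiAt (v : TangentSpace I x) (Y : ∀ x : M, TangentSpace I x) :
    TangentSpace I x :=
  S.g.nabla (S.phi Y) x v - S.φ x (S.g.nabla Y x v)

/-- For `Y` in `ker η`, `φ (∇_v φ) Y + (∇_v φ) φ Y` is a multiple of `ξ`. -/
theorem φ_nablaPhiAt_add (hη : ∀ y, S.η y (Y y) = 0) (v : TangentSpace I x) :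
    S.φ x (S.nablaPhiAt v Y) + S.nablaPhiAt v (S.phi Y) =
      S.η x (S.g.nabla Y x v) • S.ξ x := by
  rw [nablaPhiAt, nablaPhiAt, S.phi_phi_of_η_eq_zero hη, map_sub, S.φ_sq]
  abel

variable [FiniteDimensional ℝ E]

theorem mvfderiv_η (hY : DifferentiableFieldAt Y x) (v : TangentSpace I x) :
    mvfderiv I (fun y ↦ S.η y (Y y)) x v =
      S.η x (S.g.nabla Y x v) + S.g.form x (Y x) (S.g.nabla S.ξ x v) := by
  have h := S.g.mvfderiv_form hY S.differentiableFieldAt_ξ v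
  simpa only [S.form_ξ] using h

theorem η_nabla_ξ (v : TangentSpace I x) : S.η x (S.g.nabla S.ξ x v) = 0 := by
  have h := S.mvfderiv_η S.differentiableFieldAt_ξ v
  rw [S.g.symm, S.form_ξ] at h
  simp only [S.η_ξ, mvfderiv_const, zero_apply] at h
  linarith

theorem η_nabla_of_η_eq_zero (hY : DifferentiableFieldAt Y x) 
    (hη : ∀ᶠ y in 𝓝 x, S.η y (Y y) = 0) (v : TangentSpace I x) :
    S.η x (S.g.nabla Y x v) = -S.g.form x (Y x) (S.g.nabla S.ξ x v) := by
  have h := S.mvfderiv_η hY v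
  rw [mvfderiv_congr hη, mvfderiv_const, zero_apply] at h
  linarith

theorem form_nablaPhiAt (hY : DifferentiableFieldAt Y x) (hZ : DifferentiableFieldAt Z x)
    (v : TangentSpace I x) :
    S.g.form x (S.nablaPhiAt v Y) (Z x) = -S.g.form x (Y x) (S.nablaPhiAt v Z) := by
  have h1 := S.g.mvfderiv_form (S.differentiableFieldAt_phi hY) hZ v
  have h2 := S.g.mvfderiv_form hY (S.differentiableFieldAt_phi hZ) v
  have h3 : (fun y ↦ S.g.form y (S.phi Y y) (Z y)) = -(fun y ↦ S.g.form y (Y y) (S.phi Z y)) :=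
    funext fun y ↦ S.form_φ _ _
  rw [h3, mvfderiv_neg, neg_apply, h2] at h1
  simp only [nablaPhiAt, map_sub, sub_apply, S.form_φ] at h1 ⊢
  simp only [phi, S.form_φ] at h1 ⊢
  linarith

theorem nablaPhiAt_ξ (v : TangentSpace I x) :
    S.nablaPhiAt v S.ξ = -S.φ x (S.g.nabla S.ξ x v) := by
  rw [nablaPhiAt, phi_ξ, S.g.nabla_zero, zero_sub]

section Normal

variable {S} (hS : S.IsNormal)
include hS

theorem IsNormal.nabla_ξ_ξ : S.g.nabla S.ξ x (S.ξ x) = 0 := by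
  refine S.g.nondegenerate x _ fun w ↦ ?_
  have hw := smoothFieldAt_extend (I := I) w
  have h := congrArg (S.η x) (hS x _ S.ξ hw S.smoothFieldAt_ξ)
  have hb := S.g.mlieBracket_eq_nabla hw.differentiableFieldAt S.differentiableFieldAt_ξ
  simp only [nijenhuis, twoDeta, phi_ξ, mlieBracket_zero_right, map_sub, map_add, map_smul,
    S.η_φ, S.η_ξ, Pi.zero_apply, map_zero, mvfderiv_const, zero_apply, smul_eq_mul,
    S.mvfderiv_η hw.differentiableFieldAt, hb, S.η_nabla_ξ, FiberBundle.extend_apply_self] at h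
  rw [S.g.symm]
  linarith

/-- `∇ξ` commutes with `φ` once `(∇_ξ φ) = 0`. -/
theorem IsNormal.nabla_ξ_φ {v : TangentSpace I x}
    (hP : ∀ Y, SmoothFieldAt Y x → S.nablaPhiAt (S.ξ x) Y = 0) :
    S.g.nabla S.ξ x (S.φ x v) = S.φ x (S.g.nabla S.ξ x v) := by
  have hw := smoothFieldAt_extend (I := I) v
  have hw' := hw.differentiableFieldAt
  have h := congrArg (S.φ x) (hS x _ S.ξ hw S.smoothFieldAt_ξ)
  have hb := S.g.mlieBracket_eq_nabla hw' S.differentiableFieldAt_ξ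
  have hb' := S.g.mlieBracket_eq_nabla (S.differentiableFieldAt_phi hw') S.differentiableFieldAt_ξ
  have hp := hP _ hw
  rw [nablaPhiAt, sub_eq_zero] at hp
  simp only [nijenhuis, phi_ξ, mlieBracket_zero_right, map_sub, map_smul, Pi.zero_apply, map_zero,
    hb, hb', S.φ_ξ, smul_zero, add_zero, sub_zero, hp] at h
  simp only [phi, FiberBundle.extend_apply_self, S.φ_sq, S.η_nabla_ξ, zero_smul,
    sub_zero] at h
  simp only [map_sub, map_smul, S.φ_ξ, smul_zero, sub_zero] at h
  rw [← sub_eq_zero, ← neg_eq_zero]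
  rw [← h]
  abel

theorem IsNormal.η_mlieBracket_ξ (hY : DifferentiableFieldAt Y x) :
    S.η x (mlieBracket I S.ξ Y x) = mvfderiv I (fun y ↦ S.η y (Y y)) x (S.ξ x) := by
  rw [S.mvfderiv_η hY, S.g.mlieBracket_eq_nabla S.differentiableFieldAt_ξ hY, map_sub,
    S.η_nabla_ξ, hS.nabla_ξ_ξ]
  simp

end Normal

end AlmostParacontactMetric

end StructureIdentities

section AffineReeb

variable {E : Type*} [NormedAddCommGroup E] [NormedSpace ℝ E] [FiniteDimensional ℝ E]
  {H : Type*} [TopologicalSpace H] {I : ModelWithCorners ℝ E H}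
  {M : Type*} [TopologicalSpace M] [ChartedSpace H M] [IsManifold I ∞ M]
  {X Y : ∀ x : M, TangentSpace I x} {x : M}

namespace AlmostParacontactMetric

variable {S : AlmostParacontactMetric I M}

/-- If `ξ` is affine Killing, then `(L_ξ g)(Y, ∇_X ξ) = 0` for `Y` in `ker η`. -/
theorem IsNormal.form_nabla_nabla_ξ (hS : S.IsNormal) (haffine : S.g.IsAffineKilling S.ξ)
    (hX : SmoothFieldAt X x) (hY : SmoothFieldAt Y x) (hη : ∀ y, S.η y (Y y) = 0)
    (hXξ : DifferentiableFieldAt (S.g.cov X S.ξ) x) (hXY : DifferentiableFieldAt (S.g.cov X Y) x) :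
    S.g.form x (S.g.nabla S.ξ x (Y x)) (S.g.nabla S.ξ x (X x)) +
      S.g.form x (Y x) (S.g.nabla S.ξ x (S.g.nabla S.ξ x (X x))) = 0 := by
  have : CompleteSpace E := FiniteDimensional.complete ℝ E
  have hξ := S.differentiableFieldAt_ξ (x := x)
  have hYx := hY.differentiableFieldAt
  have h1 := haffine x X S.ξ hX S.smoothFieldAt_ξ
  have h2 := congrArg (S.η x) (haffine x X Y hX hY)
  have hξY := S.smoothFieldAt_ξ.mlieBracket hY
  have hcov : (fun y ↦ S.η y (S.g.cov X Y y)) =ᶠ[𝓝 x]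
      -(fun y ↦ S.g.form y (Y y) (S.g.cov X S.ξ y)) := by
    filter_upwards [hY.eventually_differentiableFieldAt] with y hy
    exact S.η_nabla_of_η_eq_zero hy (.of_forall hη) _
  have hbr : ∀ᶠ y in 𝓝 x, S.η y (mlieBracket I S.ξ Y y) = 0 := by
    filter_upwards [hY.eventually_differentiableFieldAt] with y hy
    rw [hS.η_mlieBracket_ξ hy]
    simp only [hη, mvfderiv_const, zero_apply]
  simp only [PseudoRiemannianMetric.lieDerivNabla, mlieBracket_self, map_sub, map_zero,
    PseudoRiemannianMetric.cov, S.g.nabla_zero, sub_zero] at h1 h2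
  change mlieBracket I S.ξ (S.g.cov X S.ξ) x - _ = 0 at h1
  change S.η x (mlieBracket I S.ξ (S.g.cov X Y) x) - _ - _ = 0 at h2
  rw [hS.η_mlieBracket_ξ hXY, mvfderiv_congr hcov, mvfderiv_neg, neg_apply,
    S.g.mvfderiv_form hYx hXξ, S.η_nabla_of_η_eq_zero hYx (.of_forall hη),
    S.η_nabla_of_η_eq_zero hξY.differentiableFieldAt hbr, ← sub_eq_zero.1 h1,
    S.g.mlieBracket_eq_nabla hξ hXξ, S.g.mlieBracket_eq_nabla hξ hYx] at h2
  simp only [PseudoRiemannianMetric.cov, map_sub, sub_apply] at h2 ⊢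
  linarith

end AlmostParacontactMetric

end AffineReeb

section ThreeManifold

variable {M : Type*} [TopologicalSpace M]
  [ChartedSpace (EuclideanSpace ℝ (Fin 3)) M]

instance finiteDimensional_tangentSpace_three (x : M) :
    FiniteDimensional ℝ (TangentSpace (𝓡 3) x) :=
  inferInstanceAs (FiniteDimensional ℝ (EuclideanSpace ℝ (Fin 3)))

theorem finrank_tangentSpace_three (x : M) : Module.finrank ℝ (TangentSpace (𝓡 3) x) = 3 :=
  finrank_euclideanSpace_fin

variable [IsManifold (𝓡 3) ∞ M]
  {X Y : ∀ x : M, TangentSpace (𝓡 3) x} {x : M}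

namespace AlmostParacontactMetric

variable (S : AlmostParacontactMetric (𝓡 3) M)

theorem exists_form_self_ne_zero (x : M) :
    ∃ v : TangentSpace (𝓡 3) x, S.η x v = 0 ∧ S.g.form x v v ≠ 0 := by
  by_contra! h
  have hker : ∀ u, S.η x u = 0 → u = 0 := by
    intro u hu
    refine S.g.nondegenerate x u fun w ↦ ?_
    have hw : S.η x (S.φ x (S.φ x w)) = 0 := S.η_φ x _
    have h1 := h (u + S.φ x (S.φ x w)) (by rw [map_add, hu, hw, add_zero])
    have h2 := h u hu
    have h3 := h _ hw
    simp only [map_add, add_apply, h2, h3, S.g.symm x (S.φ x (S.φ x w)) u] at h1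
    rw [S.φ_sq, map_sub, map_smul, S.form_ξ, hu] at h1
    simp only [smul_eq_mul, mul_zero, sub_zero] at h1
    linarith
  have hfin : Module.finrank ℝ (TangentSpace (𝓡 3) x) ≤ 1 := by
    refine finrank_le_one (S.ξ x) fun w ↦ ⟨S.η x w, ?_⟩
    have h1 := hker (w - S.η x w • S.ξ x) (by simp [S.η_ξ])
    exact (sub_eq_zero.1 h1).symm
  rw [finrank_tangentSpace_three x] at hfin
  omega

variable {v w : TangentSpace (𝓡 3) x}

theorem eq_zero_of_form_eq_zero (hv : S.η x v = 0) (hvv : S.g.form x v v ≠ 0)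
    (h1 : S.g.form x w v = 0) (h2 : S.g.form x w (S.φ x v) = 0) (h3 : S.η x w = 0) : w = 0 := by
  have hφv : S.g.form x (S.φ x v) (S.φ x v) = -S.g.form x v v := by
    rw [S.form_φ, S.φ_sq_of_η_eq_zero hv]
  have hli : LinearIndependent ℝ ![v, S.φ x v, S.ξ x] := by
    rw [Fintype.linearIndependent_iff]
    intro c hc
    simp only [Fin.sum_univ_three, Matrix.cons_val] at hc
    have hc0 := congrArg (fun t ↦ S.g.form x t v) hc
    have hc1 := congrArg (fun t ↦ S.g.form x t (S.φ x v)) hc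
    have hc2 := congrArg (S.η x) hc
    simp only [map_add, map_smul, add_apply, smul_apply, S.g.symm x (S.ξ x), S.form_ξ, hv, S.η_φ,
      S.η_ξ, hφv, S.form_φ_self, S.g.symm x (S.φ x v) v, smul_eq_mul, mul_zero, add_zero,
      zero_add, mul_one, mul_neg, neg_eq_zero, map_zero, zero_apply, mul_eq_zero, hvv,
      or_false] at hc0 hc1 hc2
    intro i
    fin_cases i
    exacts [hc0, hc1, hc2]
  have hspan : Submodule.span ℝ (Set.range ![v, S.φ x v, S.ξ x]) = ⊤ :=
    hli.span_eq_top_of_card_eq_finrank' (by rw [finrank_tangentSpace_three x]; simp)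
  have hle : (⊤ : Submodule ℝ (TangentSpace (𝓡 3) x)) ≤
      LinearMap.ker (S.g.form x w).toLinearMap := by
    rw [← hspan, Submodule.span_le]
    rintro _ ⟨i, rfl⟩
    fin_cases i <;> simp [h1, h2, h3, S.form_ξ]
  exact S.g.nondegenerate x w fun u ↦ hle (Submodule.mem_top (x := u))

/-- The expansion of a vector in the orthogonal frame `v`, `φ v`, `ξ`. -/
theorem eq_frame_expansion (hv : S.η x v = 0) (hvv : S.g.form x v v ≠ 0)
    (w : TangentSpace (𝓡 3) x) :
    w = (S.g.form x w v / S.g.form x v v) • v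
      - (S.g.form x w (S.φ x v) / S.g.form x v v) • S.φ x v + S.η x w • S.ξ x := by
  have hφv : S.g.form x (S.φ x v) (S.φ x v) = -S.g.form x v v := by
    rw [S.form_φ, S.φ_sq_of_η_eq_zero hv]
  have hφv' : S.g.form x (S.φ x v) v = 0 := by rw [S.g.symm, S.form_φ_self]
  have hξ : ∀ u, S.g.form x (S.ξ x) u = S.η x u := fun u ↦ by rw [S.g.symm, S.form_ξ]
  rw [← sub_eq_zero]
  refine S.eq_zero_of_form_eq_zero hv hvv ?_ ?_ ?_ <;>
    simp only [map_sub, map_add, map_smul, sub_apply, add_apply, smul_apply, smul_eq_mul,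
      hφv, hφv', S.form_φ_self, hξ, hv, S.η_φ, S.η_ξ] <;>
    field_simp <;> ring

theorem smoothFieldAt_cov (hX : SmoothFieldAt X x) (hY : SmoothFieldAt Y x) :
    SmoothFieldAt (S.g.cov X Y) x := by
  obtain ⟨v, hv, hvv⟩ := S.exists_form_self_ne_zero x
  obtain ⟨Z, hZ, hη, rfl⟩ := S.exists_smooth_extension hv
  have hξ := S.smoothFieldAt_ξ (x := x)
  have hφZ := S.smoothFieldAt_phi hZ
  have hZZ := S.g.contMDiffAt_form hZ hZ
  have h := (((S.contMDiffAt_form_cov hX hY hZ).div₀ hZZ hvv).smul_section hZ).sub_section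
    (((S.contMDiffAt_form_cov hX hY hφZ).div₀ hZZ hvv).smul_section hφZ) |>.add_section
    ((S.contMDiffAt_form_cov hX hY hξ).smul_section hξ)
  refine ContMDiffAt.congr_of_eventuallyEq h ?_
  filter_upwards [hZZ.continuousAt.eventually_ne hvv] with y hy
  have h1 := S.eq_frame_expansion (hη y) hy (S.g.cov X Y y)
  rw [← S.form_ξ] at h1
  exact congrArg (TotalSpace.mk' _ y) h1

/-- In dimension three the structure equations alone give
`(∇_v φ) Y = g(φ ∇_v ξ, Y) ξ - η(Y) φ ∇_v ξ`. -/
theorem nablaPhiAt_eq (hY : DifferentiableFieldAt Y x) (u : TangentSpace (𝓡 3) x) :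
    S.nablaPhiAt u Y = S.g.form x (S.φ x (S.g.nabla S.ξ x u)) (Y x) • S.ξ x
      - S.η x (Y x) • S.φ x (S.g.nabla S.ξ x u) := by
  obtain ⟨v, hv, hvv⟩ := S.exists_form_self_ne_zero x
  obtain ⟨Z, hZ, hη, rfl⟩ := S.exists_smooth_extension hv
  have hZ' := hZ.differentiableFieldAt
  have hφZ := S.differentiableFieldAt_phi hZ'
  have hξ := S.differentiableFieldAt_ξ (x := x)
  set a := S.φ x (S.g.nabla S.ξ x u) with ha
  have hηa : S.η x a = 0 := S.η_φ x _
  have hη' : ∀ y, S.η y (S.phi Z y) = 0 := fun y ↦ S.η_φ y _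
  -- the defining formula on the fields of the frame
  have key : ∀ W, DifferentiableFieldAt W x → S.η x (W x) = 0 →
      S.g.form x (S.nablaPhiAt u W) (Z x) = 0 →
      S.g.form x (S.nablaPhiAt u W) (S.phi Z x) = 0 →
      S.nablaPhiAt u W = S.g.form x a (W x) • S.ξ x := by
    intro W hW hηW h1 h2
    have h3 := S.form_nablaPhiAt hW hξ u
    rw [S.form_ξ, S.nablaPhiAt_ξ, map_neg, neg_neg, ← ha] at h3
    rw [S.eq_frame_expansion hv hvv (S.nablaPhiAt u W), h1, h3, S.g.symm x a]
    change _ - (S.g.form x (S.nablaPhiAt u W) (S.phi Z x) / _) • _ + _ = _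
    rw [h2]
    simp
  have hcross := S.φ_nablaPhiAt_add hη u
  have hc1 := congrArg (fun t ↦ S.g.form x t (Z x)) hcross
  have e1 : S.g.form x (S.nablaPhiAt u Z) (Z x) = 0 := by
    have := S.form_nablaPhiAt hZ' hZ' u
    rw [S.g.symm x (Z x)] at this
    linarith
  have e2 : S.g.form x (S.nablaPhiAt u (S.phi Z)) (S.phi Z x) = 0 := by
    have := S.form_nablaPhiAt hφZ hφZ u
    rw [S.g.symm x (S.phi Z x)] at this
    linarith
  have e3 := S.form_nablaPhiAt hφZ hZ' u
  rw [S.g.symm x (S.phi Z x)] at e3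
  have e4 : S.g.form x (S.nablaPhiAt u Z) (S.phi Z x) = 0 := by
    simp only [map_add, map_smul, add_apply, smul_apply, S.form_φ, S.g.symm x (S.ξ x),
      S.form_ξ, hη, smul_zero] at hc1
    change -S.g.form x _ (S.phi Z x) + _ = 0 at hc1
    linarith
  have hPZ := key Z hZ' (hη x) e1 e4
  have hPφZ := key (S.phi Z) hφZ (hη' x) (by rw [e3, e4, neg_zero]) e2
  have hPξ := S.nablaPhiAt_ξ u
  rw [← ha] at hPξ
  rw [← sub_eq_zero]
  refine S.eq_zero_of_form_eq_zero hv hvv ?_ ?_ ?_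
  · rw [map_sub, sub_apply, S.form_nablaPhiAt hY hZ', hPZ]
    simp only [map_sub, map_smul, sub_apply, smul_apply, S.g.symm x (S.ξ x), S.form_ξ, hη,
      smul_eq_mul, mul_zero]
    ring
  · change S.g.form x _ (S.phi Z x) = 0
    rw [map_sub, sub_apply, S.form_nablaPhiAt hY hφZ, hPφZ]
    simp only [map_sub, map_smul, sub_apply, smul_apply, S.g.symm x (S.ξ x), S.form_ξ, hη',
      smul_eq_mul, mul_zero]
    ring
  · have h3 := S.form_nablaPhiAt hY hξ u
    rw [S.form_ξ, hPξ, map_neg, neg_neg, S.g.symm] at h3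
    simp only [map_sub, map_smul, h3, S.η_ξ, hηa, smul_eq_mul]
    ring

theorem trace_φ_sq :
    LinearMap.trace ℝ (TangentSpace (𝓡 3) x) ((S.φ x).comp (S.φ x)).toLinearMap = 2 := by
  have h : ((S.φ x).comp (S.φ x)).toLinearMap =
      LinearMap.id - (S.η x).toLinearMap.smulRight (S.ξ x) := by
    ext1 w
    exact S.φ_sq x w
  rw [h, map_sub, LinearMap.trace_smulRight, LinearMap.trace_id, finrank_tangentSpace_three x]
  simp [S.η_ξ]
  norm_num

end AlmostParacontactMetric

end ThreeManifold

section AffineReebThreeManifold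

variable {M : Type*} [TopologicalSpace M]
  [ChartedSpace (EuclideanSpace ℝ (Fin 3)) M] [IsManifold (𝓡 3) ∞ M]
  {X Y : ∀ x : M, TangentSpace (𝓡 3) x} {x : M}

namespace AlmostParacontactMetric

variable {S : AlmostParacontactMetric (𝓡 3) M}

theorem IsNormal.nabla_ξ_comm_φ (hS : S.IsNormal) (v : TangentSpace (𝓡 3) x) :
    S.g.nabla S.ξ x (S.φ x v) = S.φ x (S.g.nabla S.ξ x v) := by
  refine hS.nabla_ξ_φ fun Y hY ↦ ?_
  rw [S.nablaPhiAt_eq hY.differentiableFieldAt, hS.nabla_ξ_ξ]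
  simp

/-- On a normal three-manifold with affine Killing Reeb field, `∇ξ` is a multiple of `φ`. -/
theorem IsNormal.exists_nabla_ξ_eq (hS : S.IsNormal) (haffine : S.g.IsAffineKilling S.ξ) (x : M) :
    ∃ b : ℝ, ∀ w, S.g.nabla S.ξ x w = b • S.φ x w := by
  obtain ⟨v, hv, hvv⟩ := S.exists_form_self_ne_zero x
  obtain ⟨Z, hZ, hη, rfl⟩ := S.exists_smooth_extension hv
  have haff := hS.form_nabla_nabla_ξ haffine hZ hZ hη
    (S.smoothFieldAt_cov hZ S.smoothFieldAt_ξ).differentiableFieldAt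
    (S.smoothFieldAt_cov hZ hZ).differentiableFieldAt
  have hAv := S.eq_frame_expansion hv hvv (S.g.nabla S.ξ x (Z x))
  rw [S.η_nabla_ξ, zero_smul, add_zero] at hAv
  set v := Z x
  set a := S.g.form x (S.g.nabla S.ξ x v) v / S.g.form x v v
  set b := S.g.form x (S.g.nabla S.ξ x v) (S.φ x v) / S.g.form x v v
  have hφv : S.g.form x (S.φ x v) (S.φ x v) = -S.g.form x v v := by
    rw [S.form_φ, S.φ_sq_of_η_eq_zero hv]
  have hAφv : S.g.nabla S.ξ x (S.φ x v) = a • S.φ x v - b • v := by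
    rw [hS.nabla_ξ_comm_φ, hAv, map_sub, map_smul, map_smul, S.φ_sq_of_η_eq_zero hv]
  have ha : a = 0 := by
    simp only [hAv, hAφv, map_sub, map_smul, sub_apply, smul_apply, smul_eq_mul, hφv,
      S.form_φ_self, S.g.symm x (S.φ x v) v] at haff
    have : a * a * S.g.form x v v = 0 := by linarith
    simpa [hvv] using this
  refine ⟨-b, fun w ↦ ?_⟩
  have hw := S.eq_frame_expansion hv hvv w
  rw [hw]
  simp only [map_sub, map_add, map_smul, hAφv, hS.nabla_ξ_ξ, S.φ_ξ, S.φ_sq_of_η_eq_zero hv]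
  rw [hAv, ha]
  module

variable (hS : S.IsNormal) (haffine : S.g.IsAffineKilling S.ξ)
include hS haffine

theorem IsNormal.nabla_ξ_eq (w : TangentSpace (𝓡 3) x) :
    S.g.nabla S.ξ x w = (S.trPhiNablaXi x / 2) • S.φ x w := by
  obtain ⟨b, hb⟩ := hS.exists_nabla_ξ_eq haffine x
  have h : S.trPhiNablaXi x = b * 2 := by
    have h1 : ((S.φ x).comp (S.g.nabla S.ξ x)).toLinearMap =
        b • ((S.φ x).comp (S.φ x)).toLinearMap := by
      ext1 w
      simp [hb]
    rw [trPhiNablaXi, h1, map_smul, S.trace_φ_sq, smul_eq_mul]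
  rw [h, hb, mul_div_cancel_right₀ b two_ne_zero]

theorem IsNormal.isKilling_ξ : S.g.IsKilling S.ξ := by
  intro x X Y hX hY
  rw [S.g.lieDeriv_eq S.differentiableFieldAt_ξ hX.differentiableFieldAt hY.differentiableFieldAt,
    hS.nabla_ξ_eq haffine, hS.nabla_ξ_eq haffine]
  simp only [map_smul, smul_apply, smul_eq_mul, S.form_φ]
  ring

theorem IsNormal.hasNablaPhi : S.HasNablaPhi 0 fun x ↦ S.trPhiNablaXi x / 2 := by
  intro x X Y hX hY
  change S.nablaPhiAt (X x) Y = _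
  rw [S.nablaPhiAt_eq hY.differentiableFieldAt, hS.nabla_ξ_eq haffine, map_smul, S.φ_sq]
  simp only [map_smul, map_sub, smul_apply, sub_apply, S.g.symm x (S.ξ x), S.form_ξ, Pi.zero_apply,
    smul_eq_mul]
  module

theorem IsNormal.contMDiff_trPhiNablaXi : ContMDiff (𝓡 3) 𝓘(ℝ, ℝ) ∞ S.trPhiNablaXi := by
  intro x
  obtain ⟨v, hv, hvv⟩ := S.exists_form_self_ne_zero x
  obtain ⟨Z, hZ, hη, rfl⟩ := S.exists_smooth_extension hv
  have hZZ := S.g.contMDiffAt_form hZ hZ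
  have h := ((contMDiffAt_const (c := (-2 : ℝ))).mul
    (S.contMDiffAt_form_cov hZ S.smoothFieldAt_ξ (S.smoothFieldAt_phi hZ))).div₀ hZZ hvv
  refine h.congr_of_eventuallyEq ?_
  filter_upwards [hZZ.continuousAt.eventually_ne hvv] with y hy
  simp only [Pi.div_apply, Pi.mul_apply, PseudoRiemannianMetric.cov, phi,
    hS.nabla_ξ_eq haffine, map_smul, smul_apply, smul_eq_mul, S.form_φ,
    S.φ_sq_of_η_eq_zero (hη y)]
  field_simp

end AlmostParacontactMetric

end AffineReebThreeManifold

theorem mainTheorem11 {M : Type*} [TopologicalSpace M]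
    [ChartedSpace (EuclideanSpace ℝ (Fin 3)) M] [IsManifold (𝓡 3) ∞ M]
    [T2Space M] [SecondCountableTopology M] [ConnectedSpace M]
    (S : AlmostParacontactMetric (𝓡 3) M)
    (hnormal : S.IsNormal) (haffine : S.g.IsAffineKilling S.ξ) :
    S.g.IsKilling S.ξ ∧
      ((∃ x, S.trPhiNablaXi x ≠ 0) → S.IsQuasiParaSasakian) ∧
      ((∀ x, S.trPhiNablaXi x ≠ 0) → S.IsStrictlyQuasiParaSasakian) ∧
      ((∀ x, S.trPhiNablaXi x = 0) → S.IsParaCosymplectic) := by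
  have hβ : ContMDiff (𝓡 3) 𝓘(ℝ, ℝ) ∞ fun x ↦ S.trPhiNablaXi x / 2 :=
    (hnormal.contMDiff_trPhiNablaXi haffine).div_const 2
  have hP := hnormal.hasNablaPhi haffine
  refine ⟨hnormal.isKilling_ξ haffine, fun ⟨x, hx⟩ ↦ ?_, fun h ↦ ?_, fun h ↦ ?_⟩
  · exact ⟨hnormal, _, hβ, hP, x, div_ne_zero hx two_ne_zero⟩
  · exact ⟨hnormal, _, hβ, hP, fun x ↦ div_ne_zero (h x) two_ne_zero⟩
  · refine ⟨hnormal, ?_⟩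
    have h0 : (fun x ↦ S.trPhiNablaXi x / 2) = 0 := funext fun x ↦ by simp [h x]
    rwa [h0] at hP
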